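/- **Conventions.** A map between metric spaces is *coarse* if it is bornologous ($d(f(x),f(x'))\le\psi(d(x,x'))$ for some non-decreasing $\psi\colon\mathbb R_{\ge0}\to\mathbb R_{\ge0}$) and metrically proper (preimages of bounded sets are bounded). Coarse maps $f,g\colon X\to Y$ are *coarsely homotopic* if there are a bornologous map $x\mapsto T_x\in\mathbb R_{\ge 0}$ on $X$ and a coarse map $h\colon Z\to Y$ on $Z=\{(x,t)\in X\times\mathbb R_{\ge 0}: 0\le t\le T_x\}$ (with the $\ell_1$-metric) such that $h(x,0)=f(x)$ and $h(x,T_x)=g(x)$ for all $x$. A metric space $X$ is $(\lambda,k,E,C,\theta,\mathcal L)$-*coarsely convex* ($\lambda\ge1$, $k\ge0$, $E\ge1$, $C\ge0$, $\theta\colon\mathbb R_{\ge0}\to\mathbb R_{\ge0}$ non-decreasing, $\mathcal L$ a family of $(\lambda,k)$-quasi-geodesic segments) if any two points $v,w$ are joined by some $\gamma\in\mathcal L$, $\gamma\colon[0,\ell]\to X$, $\gamma(0)=v$, $\gamma(\ell)=w$, and if for all $\gamma,\eta\in\mathcal L$, all $t,s$ in their respective domains and all $0\le c\le 1$ $$d(\gamma(ct),\eta(cs))\le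 cE\,d(\gamma(t),\eta(s))+(1-c)E\,d(\gamma(0),\eta(0))+C,\qquad |t-s|\le\theta\big(d(\gamma(0),\eta(0))+d(\gamma(t),\eta(s))\big).$$ For a base point $a\in X$, $\mathcal L_a^\infty$ is the set of maps $\gamma\colon\mathbb R_{\ge0}\to X$ with $\gamma(0)=a$ and $\gamma(t)=\gamma(\lfloor t\rfloor)$ for all $t$ that are pointwise limits on $\mathbb N$ of segments $\gamma_n\in\mathcal L$ with $\gamma_n(0)=a$ whose lengths tend to infinity. The ideal boundary $\partial_aX$ is the quotient of $\mathcal L_a^\infty$ by the relation of being at bounded distance. Put $D=2(1+E)(\lambda+k)+C$, $(\gamma\mid\eta)=\sup\{t: d(\gamma(t),\eta(t))\le 2D+2\}$ for $\gamma,\eta\in\mathcal L^\infty_a$, and $(x\mid y)=\sup\{(\gamma\mid\eta):\gamma\in x,\eta\in y\}$ for $x,y\in\partial_aX$. The sets $\{y:(x\mid y)>n\}$, $n\in\mathbb N$, form a neighbourhood basis of $x$ in $\partial_aX$. Let $X^{\mathrm{Vis}}=\bigcup_{\gamma\in\mathcal L_a^\infty}\gamma(\mathbb R_{\ge0})$.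 For $\tau\ge0$, a $\tau$-*rough contraction* is a non-decreasing map $\sigma\colon\mathbb R_{\ge0}\to\mathbb R_{\ge0}$ with $\sigma(0)=0$, $\sigma(t)\to\infty$ as $t\to\infty$, $\sigma(t)\le t$ and $|\sigma(t)-\sigma(s)|\le|t-s|+\tau$ for all $t,s$. The *open cone* over a metric space $Z$ of diameter at most $2$ is $\mathcal OZ=\mathbb R_{\ge0}\times Z/(\{0\}\times Z)$ with the metric $d(tx,sy)=|t-s|+\min\{t,s\}\,d_Z(x,y)$. **Setting.** Let $X$ and $Y$ be proper coarsely convex metric spaces with base points $a\in X$, $b\in Y$ and systems $\mathcal L^X,\mathcal L^Y$ of good quasi-geodesic segments. Let $0<\varepsilon<1$ be such that each of $\partial_aX$ and $\partial_bY$ carries a metric $d$ with $K(x\mid y)^{-\varepsilon}\le d(x,y)\le(x\mid y)^{-\varepsilon}$ for some constant $0<K<1$; fix such metrics. Let $f\colon\partial_aX\to\partial_bY$ be continuous. Fix the following choices. - For each $y\in\partial_bY$ a ray $\eta_y\in y$; put $\exp_\varepsilon(ty)=\eta_y(t^{1/\varepsilon})$, a map $\mathcal O\partial_bY\to Y$.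 - For each $v\in X^{\mathrm{Vis}}$ a ray $\gamma_v\in\mathcal L_a^{X,\infty}$ and $t_v\ge0$ with $\gamma_v(t_v)=v$; put $\log^\varepsilon(v)=t_v^\varepsilon[\gamma_v]\in\mathcal O\partial_aX$. - A $1$-rough contraction $\chi$ and, for each $v\in X$, a segment $\xi_v\in\mathcal L^X$ starting at $a$ and a parameter $T_v$ with $\xi_v(T_v)=v$, such that $\varphi(v)=\xi_v(\chi(T_v))$ defines a coarse map $\varphi\colon X\to X$ with $\varphi(X)\subset X^{\mathrm{Vis}}$. Write $\mathcal Of(tz)=tf(z)$ and $\phi_r(tz)=r(t)z$. Call a $0$-rough contraction $r$ *admissible* if $\exp_\varepsilon\circ\mathcal Of\circ\phi_r\colon\mathcal O\partial_aX\to Y$ is a coarse map and $|r(t^\varepsilon)^{1/\varepsilon}-r(s^\varepsilon)^{1/\varepsilon}|\le|t-s|$ for all $t,s\ge0$ with $r(t^\varepsilon)\ge1$ and $r(s^\varepsilon)\ge1$. For such $r$ the *radial extension of $f$ associated to $r$* is $$\exp_\varepsilon\circ\mathcal Of\circ\phi_r\circ\log^\varepsilon\circ\varphi\colon X\to Y.$$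 **Proposition.** Let $r_1,r_2$ be admissible $0$-rough contractions and let $\mathrm{rad}_if$ be the radial extension of $f$ associated to $r_i$ ($i=1,2$). Then $\mathrm{rad}_1f$ and $\mathrm{rad}_2f$ are coarse maps and are coarsely homotopic. Hence the coarse homotopy class of the radial extension of $f$ does not depend on the choice of the admissible $r$. -/

import Mathlib

open Filter Topology
open scoped NNReal ENNReal

noncomputable section

namespace CoarseConvex

/-! ### Coarse maps and coarse homotopy -/

/-- There is a non-decreasing control function `ψ` with `d(f x, f x') ≤ ψ (d(x, x'))`. -/
def IsBornologous {X Y : Type*} [PseudoMetricSpace X] [PseudoMetricSpace Y] (f : X → Y) : Prop :=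
  ∃ ψ : ℝ≥0 → ℝ≥0, Monotone ψ ∧ ∀ x x' : X, nndist (f x) (f x') ≤ ψ (nndist x x')

/-- Inverse images of bounded sets are bounded. -/
def IsMetricallyProper {X Y : Type*} [PseudoMetricSpace X] [PseudoMetricSpace Y]
    (f : X → Y) : Prop :=
  ∀ B : Set Y, Bornology.IsBounded B → Bornology.IsBounded (f ⁻¹' B)

/-- A coarse map: bornologous and metrically proper. -/
def IsCoarse {X Y : Type*} [PseudoMetricSpace X] [PseudoMetricSpace Y] (f : X → Y) : Prop :=
  IsBornologous f ∧ IsMetricallyProper f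

/-- The subspace `{(x, t) : 0 ≤ t ≤ T x}` of `X × ℝ≥0`, the product having the `ℓ¹`-metric. -/
abbrev Cylinder {X : Type*} (T : X → ℝ≥0) : Type _ :=
  {p : WithLp 1 (X × ℝ≥0) // p.snd ≤ T p.fst}

/-- The point `(x, t)` of the cylinder. -/
def Cylinder.mk {X : Type*} {T : X → ℝ≥0} (x : X) (t : ℝ≥0) (h : t ≤ T x) : Cylinder T :=
  ⟨WithLp.toLp 1 (x, t), h⟩

/-- Two coarse maps are coarsely homotopic. -/
def CoarselyHomotopic {X Y : Type*} [PseudoMetricSpace X] [PseudoMetricSpace Y]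
    (f g : X → Y) : Prop :=
  IsCoarse f ∧ IsCoarse g ∧
    ∃ (T : X → ℝ≥0) (h : Cylinder T → Y),
      IsBornologous T ∧ IsCoarse h ∧
      (∀ x, h (Cylinder.mk x 0 zero_le) = f x) ∧
      (∀ x, h (Cylinder.mk x (T x) le_rfl) = g x)

/-! ### Coarsely convex spaces -/

/-- A map `[0, len] → X`. -/
structure Segment (X : Type*) where
  /-- the right end point of the domain -/
  len : ℝ≥0
  /-- the map -/
  toFun : Set.Icc (0 : ℝ≥0) len → X

/-- A segment `γ` is evaluated at every `t ≥ 0`, with `γ t = γ len` for `t ≥ len`. -/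
instance {X : Type*} : CoeFun (Segment X) (fun _ => ℝ≥0 → X) :=
  ⟨fun γ => Set.IccExtend (zero_le : (0 : ℝ≥0) ≤ γ.len) γ.toFun⟩

/-- `γ : [0, len] → X` is a `(lam, k)`-quasi-geodesic segment. -/
def Segment.IsQuasiGeodesic {X : Type*} [MetricSpace X] (lam k : ℝ) (γ : Segment X) : Prop :=
  ∀ t s : ℝ≥0, t ≤ γ.len → s ≤ γ.len →
    lam⁻¹ * dist t s - k ≤ dist (γ t) (γ s) ∧ dist (γ t) (γ s) ≤ lam * dist t s + k

/-- Constants `lam, k, E, C`, a function `theta` and a system `segs` of good quasi-geodesic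
segments for which `X` is `(lam, k, E, C, theta, segs)`-coarsely convex. -/
structure CoarselyConvex (X : Type*) [MetricSpace X] where
  lam : ℝ
  k : ℝ
  E : ℝ
  C : ℝ
  theta : ℝ≥0 → ℝ≥0
  segs : Set (Segment X)
  one_le_lam : 1 ≤ lam
  k_nonneg : 0 ≤ k
  one_le_E : 1 ≤ E
  C_nonneg : 0 ≤ C
  theta_mono : Monotone theta
  quasiGeodesic : ∀ γ ∈ segs, γ.IsQuasiGeodesic lam k
  exists_seg : ∀ v w : X, ∃ γ ∈ segs, γ 0 = v ∧ γ γ.len = w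
  convex : ∀ γ ∈ segs, ∀ η ∈ segs, ∀ t s c : ℝ≥0, t ≤ γ.len → s ≤ η.len → c ≤ 1 →
    dist (γ (c * t)) (η (c * s)) ≤
      c * E * dist (γ t) (η s) + (1 - (c : ℝ)) * E * dist (γ 0) (η 0) + C
  param_reg : ∀ γ ∈ segs, ∀ η ∈ segs, ∀ t s : ℝ≥0, t ≤ γ.len → s ≤ η.len →
    nndist t s ≤ theta (nndist (γ 0) (η 0) + nndist (γ t) (η s))

namespace CoarselyConvex

variable {X : Type*} [MetricSpace X] (S : CoarselyConvex X)

/-- The constant `k₁ = lam + k`. -/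
def k₁ : ℝ := S.lam + S.k

/-- The constant `D = 2 (1 + E) k₁ + C`. -/
def D : ℝ := 2 * (1 + S.E) * S.k₁ + S.C

/-- `γ : ℝ≥0 → X` is approximatable: there are good segments `γₙ : [0, aₙ] → X` with `aₙ → ∞`,
starting at `γ 0` and converging to `γ` pointwise on `ℕ`. -/
def IsApproximatable (γ : ℝ≥0 → X) : Prop :=
  ∃ γs : ℕ → Segment X, (∀ n, γs n ∈ S.segs) ∧ (∀ n, γs n 0 = γ 0) ∧
    Tendsto (fun n => (γs n).len) atTop atTop ∧
    ∀ m : ℕ, Tendsto (fun n => γs n (m : ℝ≥0)) atTop (𝓝 (γ (m : ℝ≥0)))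

/-- The family of good quasi-geodesic rays starting at `a`. -/
def Ray (a : X) : Type _ :=
  {γ : ℝ≥0 → X // S.IsApproximatable γ ∧ (∀ t : ℝ≥0, γ t = γ (⌊t⌋₊ : ℝ≥0)) ∧ γ 0 = a}

instance (a : X) : CoeFun (S.Ray a) (fun _ => ℝ≥0 → X) := ⟨fun γ => γ.1⟩

/-- Two rays are equivalent if they stay at bounded distance from each other. -/
def raySetoid (a : X) : Setoid (S.Ray a) where
  r γ η := ∃ M : ℝ, ∀ t : ℝ≥0, dist (γ t) (η t) ≤ M
  iseqv :=
    { refl := fun γ => ⟨0, fun t => by simp⟩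
      symm := fun ⟨M, h⟩ => ⟨M, fun t => by rw [dist_comm]; exact h t⟩
      trans := fun ⟨M, h⟩ ⟨N, h'⟩ =>
        ⟨M + N, fun t => (dist_triangle _ _ _).trans (add_le_add (h t) (h' t))⟩ }

/-- The ideal boundary with respect to the base point `a`. -/
def Boundary (a : X) : Type _ := Quotient (S.raySetoid a)

variable {S}

/-- The boundary point represented by a ray. -/
def Ray.toBoundary {a : X} (γ : S.Ray a) : S.Boundary a := Quotient.mk (S.raySetoid a) γ

variable (S)

/-- `(γ | η) = sup {t : d(γ t, η t) ≤ 2 D + 2}`, for rays `γ` and `η` starting at `a`. -/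
def rayProd {a : X} (γ η : S.Ray a) : ℝ≥0∞ :=
  ⨆ (t : ℝ≥0) (_ : dist (γ t) (η t) ≤ 2 * S.D + 2), (t : ℝ≥0∞)

/-- `(x | y) = sup {(γ | η) : γ ∈ x, η ∈ y}`, for boundary points `x` and `y`. -/
def prod {a : X} (x y : S.Boundary a) : ℝ≥0∞ :=
  ⨆ (γ : S.Ray a) (η : S.Ray a) (_ : γ.toBoundary = x) (_ : η.toBoundary = y), S.rayProd γ η

/-- The topology of the ideal boundary: the sets `{y : (x | y) > n}` form a fundamental system of
neighbourhoods of `x`. -/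
instance (a : X) : TopologicalSpace (S.Boundary a) where
  IsOpen U := ∀ x ∈ U, ∃ n : ℕ, ∀ y, (n : ℝ≥0∞) < S.prod x y → y ∈ U
  isOpen_univ := fun _ _ => ⟨0, fun _ _ => trivial⟩
  isOpen_inter := by
    intro U V hU hV x hx
    obtain ⟨n, hn⟩ := hU x hx.1
    obtain ⟨m, hm⟩ := hV x hx.2
    refine ⟨max n m, fun y hy => ⟨hn y (lt_of_le_of_lt ?_ hy), hm y (lt_of_le_of_lt ?_ hy)⟩⟩
    · exact_mod_cast le_max_left n m
    · exact_mod_cast le_max_right n m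
  isOpen_sUnion := by
    intro 𝒰 h𝒰 x hx
    obtain ⟨U, hU, hxU⟩ := hx
    obtain ⟨n, hn⟩ := h𝒰 U hU x hxU
    exact ⟨n, fun y hy => ⟨U, hU, hn y hy⟩⟩

/-- A metric `d` on the ideal boundary with `K (x | y)^(-ε) ≤ d(x, y) ≤ (x | y)^(-ε)`
for some constant `K` with `0 < K < 1` (where `∞^(-ε) = 0`). -/
structure BoundaryMetric (a : X) (ε : ℝ) where
  metric : MetricSpace (S.Boundary a)
  K : ℝ≥0
  K_pos : 0 < K
  K_lt_one : K < 1
  lower : ∀ x y, (K : ℝ≥0∞) * S.prod x y ^ (-ε) ≤ ENNReal.ofReal (metric.dist x y)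
  upper : ∀ x y, ENNReal.ofReal (metric.dist x y) ≤ S.prod x y ^ (-ε)

/-- The union of the images of all good rays starting at `a`. -/
def vis (a : X) : Set X := {v | ∃ (γ : S.Ray a) (t : ℝ≥0), γ t = v}

end CoarselyConvex

/-! ### Open cones -/

/-- The relation collapsing `{0} × Z` to a point. -/
def coneSetoid (Z : Type*) : Setoid (ℝ≥0 × Z) where
  r p q := p = q ∨ (p.1 = 0 ∧ q.1 = 0)
  iseqv :=
    { refl := fun _ => Or.inl rfl
      symm := by
        rintro p q (h | h)
        · exact Or.inl h.symm
        · exact Or.inr h.symm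
      trans := by
        rintro p q r (rfl | h) (rfl | h')
        · exact Or.inl rfl
        · exact Or.inr h'
        · exact Or.inr h
        · exact Or.inr ⟨h.1, h'.2⟩ }

/-- The open cone `(ℝ≥0 × Z) / ({0} × Z)`. -/
def OpenCone (Z : Type*) : Type _ := Quotient (coneSetoid Z)

namespace OpenCone

variable {Z W : Type*}

/-- The point `t z` of the open cone. -/
def mk (t : ℝ≥0) (z : Z) : OpenCone Z := Quotient.mk (coneSetoid Z) (t, z)

/-- A map on `ℝ≥0 × Z` that is constant on `{0} × Z` descends to the open cone. -/
def lift {β : Type*} (F : ℝ≥0 → Z → β) (hF : ∀ z z', F 0 z = F 0 z') : OpenCone Z → β :=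
  Quotient.lift (fun p : ℝ≥0 × Z => F p.1 p.2) (by
    rintro ⟨t, z⟩ ⟨s, w⟩ (h | ⟨h, h'⟩)
    · rw [h]
    · dsimp only at h h' ⊢
      rw [h, h']
      exact hF z w)

theorem mk_zero (z z' : Z) : mk 0 z = mk 0 z' := Quotient.sound (Or.inr ⟨rfl, rfl⟩)

theorem ind {P : OpenCone Z → Prop} (h : ∀ t z, P (mk t z)) (p : OpenCone Z) : P p :=
  Quotient.ind (fun q => h q.1 q.2) p

/-- The distance `d(t z, s w) = |t - s| + min t s * d(z, w)`. -/
def coneDist [MetricSpace Z] : OpenCone Z → OpenCone Z → ℝ :=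
  lift (fun t z => lift (fun s w => |(t : ℝ) - s| + min (t : ℝ) s * dist z w)
      (by intro w w'; simp))
    (by
      intro z z'
      funext q
      induction q using ind with
      | h s w => change |((0 : ℝ≥0) : ℝ) - s| + _ = |((0 : ℝ≥0) : ℝ) - s| + _; simp)

theorem coneDist_mk [MetricSpace Z] (t s : ℝ≥0) (z w : Z) :
    coneDist (mk t z) (mk s w) = |(t : ℝ) - s| + min (t : ℝ) s * dist z w := rfl

/-- The metric of the open cone over a metric space of diameter at most `2`. -/
@[reducible] def metricSpace [MetricSpace Z] (hZ : ∀ z w : Z, dist z w ≤ 2) : MetricSpace (OpenCone Z) where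
  dist := coneDist
  dist_self p := by
    induction p using ind with
    | h t z => simp [coneDist_mk]
  dist_comm p q := by
    induction p using ind with
    | h t z =>
      induction q using ind with
      | h s w => simp only [coneDist_mk]; rw [abs_sub_comm, min_comm, dist_comm]
  dist_triangle p q u := by
    induction p using ind with
    | h t z =>
      induction q using ind with
      | h s w =>
        induction u using ind with
        | h r v =>
          simp only [coneDist_mk]
          have ht := t.2
          have hs := s.2
          have hr := r.2
          have h1 := dist_triangle z w v
          have h2 := hZ z v
          have h3 := dist_nonneg (x := z) (y := w)
          have h4 := dist_nonneg (x := w) (y := v)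
          have h5 := dist_nonneg (x := z) (y := v)
          change (0 : ℝ) ≤ (t : ℝ) at ht
          change (0 : ℝ) ≤ (s : ℝ) at hs
          change (0 : ℝ) ≤ (r : ℝ) at hr
          generalize (t : ℝ) = t' at *
          generalize (s : ℝ) = s' at *
          generalize (r : ℝ) = r' at *
          rcases le_total (min t' r') s' with h | h
          · have e1 : min t' r' ≤ min t' s' := le_min (min_le_left _ _) h
            have e2 : min t' r' ≤ min s' r' := le_min h (min_le_right _ _)
            have e3 := abs_sub_le t' s' r'
            have e4 : 0 ≤ min t' r' := le_min ht hr
            nlinarith [mul_le_mul_of_nonneg_right e1 h3, mul_le_mul_of_nonneg_right e2 h4,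
              mul_le_mul_of_nonneg_left h1 e4]
          · have e1 : s' ≤ t' := h.trans (min_le_left _ _)
            have e2 : s' ≤ r' := h.trans (min_le_right _ _)
            rw [min_eq_right e1, min_eq_left e2, abs_of_nonneg (sub_nonneg.2 e1), abs_sub_comm s' r',
              abs_of_nonneg (sub_nonneg.2 e2)]
            have e3 : (min t' r' - s') * dist z v ≤ (min t' r' - s') * 2 :=
              mul_le_mul_of_nonneg_left h2 (sub_nonneg.2 h)
            have e4 := mul_le_mul_of_nonneg_left h1 hs
            have e5 : |t' - r'| + 2 * min t' r' = t' + r' := by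
              rcases le_total t' r' with h' | h'
              · rw [min_eq_left h', abs_sub_comm, abs_of_nonneg (sub_nonneg.2 h')]; ring
              · rw [min_eq_right h', abs_of_nonneg (sub_nonneg.2 h')]; ring
            nlinarith
  eq_of_dist_eq_zero {p q} := by
    induction p using ind with
    | h t z =>
      induction q using ind with
      | h s w =>
        intro h
        change |(t : ℝ) - s| + min (t : ℝ) s * dist z w = 0 at h
        have h0 : 0 ≤ min (t : ℝ) s * dist z w :=
          mul_nonneg (le_min t.2 s.2) dist_nonneg
        have h1 : |(t : ℝ) - s| = 0 := le_antisymm (by linarith) (abs_nonneg _)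
        have h2 : t = s := NNReal.coe_injective (sub_eq_zero.1 (abs_eq_zero.1 h1))
        subst h2
        rw [h1, zero_add, min_self] at h
        rcases mul_eq_zero.1 h with h | h
        · have h3 : t = 0 := NNReal.coe_injective h
          subst h3
          exact mk_zero z w
        · rw [dist_eq_zero.1 h]

/-- The map `t z ↦ t f(z)` induced by `f`. -/
def map (f : Z → W) : OpenCone Z → OpenCone W :=
  lift (fun t z => mk t (f z)) (fun z z' => mk_zero (f z) (f z'))

/-- The radial contraction `t z ↦ r(t) z`. -/
def radial (r : ℝ≥0 → ℝ≥0) (hr : r 0 = 0) : OpenCone Z → OpenCone Z :=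
  lift (fun t z => mk (r t) z) (fun z z' => by simp only [hr]; exact mk_zero z z')

end OpenCone

/-! ### Rough contractions, logarithm, exponential, radial extension -/

/-- `σ` is a `τ`-rough contraction. -/
structure IsRoughContraction (τ : ℝ≥0) (σ : ℝ≥0 → ℝ≥0) : Prop where
  map_zero : σ 0 = 0
  tendsto : Tendsto σ atTop atTop
  le_self : ∀ t, σ t ≤ t
  dist_le : ∀ t s, dist (σ t) (σ s) ≤ dist t s + τ
  mono : Monotone σ

namespace CoarselyConvex

variable {X : Type*} [MetricSpace X] {S : CoarselyConvex X}

theorem one_le_prod {a : X} (x y : S.Boundary a) : 1 ≤ S.prod x y := by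
  obtain ⟨γ, rfl⟩ := Quotient.exists_rep x
  obtain ⟨η, rfl⟩ := Quotient.exists_rep y
  have h : S.rayProd γ η ≤ S.prod (Quotient.mk (S.raySetoid a) γ) (Quotient.mk _ η) :=
    le_iSup_of_le γ (le_iSup_of_le η (le_iSup_of_le rfl (le_iSup_of_le rfl le_rfl)))
  refine le_trans ?_ h
  have hlt : ∀ t : ℝ≥0, t < 1 → (t : ℝ≥0∞) ≤ S.rayProd γ η := by
    intro t ht
    refine le_iSup_of_le t (le_iSup_of_le ?_ le_rfl)
    have hfl : ⌊t⌋₊ = 0 := Nat.floor_eq_zero.2 ht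
    have h1 : γ.1 t = a := by rw [γ.2.2.1 t, hfl, Nat.cast_zero, γ.2.2.2]
    have h2 : η.1 t = a := by rw [η.2.2.1 t, hfl, Nat.cast_zero, η.2.2.2]
    rw [h1, h2, dist_self]
    have := S.one_le_lam
    have := S.k_nonneg
    have := S.one_le_E
    have := S.C_nonneg
    unfold D k₁
    positivity
  refine le_of_forall_lt fun c hc => ?_
  lift c to ℝ≥0 using ne_top_of_lt hc
  have hc' : c < 1 := by exact_mod_cast hc
  obtain ⟨d, hcd, hd⟩ := exists_between hc'
  exact lt_of_lt_of_le (by exact_mod_cast hcd) (hlt d hd)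

theorem BoundaryMetric.dist_le_two {a : X} {ε : ℝ} (hε : 0 < ε) (M : S.BoundaryMetric a ε)
    (x y : S.Boundary a) : M.metric.dist x y ≤ 2 := by
  have h1 : ENNReal.ofReal (M.metric.dist x y) ≤ 1 :=
    (M.upper x y).trans (ENNReal.rpow_le_one_of_one_le_of_neg (one_le_prod x y) (by linarith))
  have h2 : M.metric.dist x y ≤ 1 := by
    rwa [← ENNReal.ofReal_one, ENNReal.ofReal_le_ofReal_iff zero_le_one] at h1
  linarith

/-- The open cone over the ideal boundary, with the metric induced by the boundary metric. -/
abbrev BoundaryMetric.cone {a : X} {ε : ℝ} (hε : 0 < ε) (M : S.BoundaryMetric a ε) :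
    MetricSpace (OpenCone (S.Boundary a)) :=
  @OpenCone.metricSpace _ M.metric (M.dist_le_two hε)

variable (S)

/-- A choice, for every point `v` of the union of the good rays starting at `a`, of such a ray
`ray v` and a parameter `time v` with `ray v (time v) = v`. -/
structure LogChoice (a : X) where
  ray : S.vis a → S.Ray a
  time : S.vis a → ℝ≥0
  ray_time : ∀ v, ray v (time v) = (v : X)

/-- A choice of a representing ray for every boundary point. -/
structure ExpChoice (b : X) where
  ray : S.Boundary b → S.Ray b
  toBoundary_ray : ∀ y, (ray y).toBoundary = y

variable {S}

/-- The logarithmic map `v ↦ t_v^ε [γ_v]`. -/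
def LogChoice.log {a : X} (c : S.LogChoice a) (ε : ℝ) (v : S.vis a) : OpenCone (S.Boundary a) :=
  OpenCone.mk (c.time v ^ ε) (c.ray v).toBoundary

/-- The exponential map `t y ↦ η_y(t^(1/ε))`. -/
def ExpChoice.exp {b : X} (c : S.ExpChoice b) {ε : ℝ} (hε : 0 < ε) :
    OpenCone (S.Boundary b) → X :=
  OpenCone.lift (fun t y => c.ray y (t ^ (1 / ε))) (by
    intro y y'
    have h : (0 : ℝ≥0) ^ (1 / ε) = 0 := NNReal.zero_rpow (one_div_pos.2 hε).ne'
    simp only [h]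
    rw [(c.ray y).2.2.2, (c.ray y').2.2.2])

variable (S)

/-- A deformation of `X` into the union of the good rays starting at `a`: a `1`-rough contraction
`χ` and, for every `v`, a good segment `γ_v` starting at `a` and a parameter `T_v` with
`v = γ_v(T_v)`, such that `φ : v ↦ γ_v(χ(T_v))` is a coarse map with values in that union. -/
structure Deformation (a : X) where
  χ : ℝ≥0 → ℝ≥0
  rough : IsRoughContraction 1 χ
  seg : X → Segment X
  time : X → ℝ≥0
  seg_mem : ∀ v, seg v ∈ S.segs
  seg_zero : ∀ v, seg v 0 = a
  time_le : ∀ v, time v ≤ (seg v).len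
  seg_time : ∀ v, seg v (time v) = v
  mem_vis : ∀ v, seg v (χ (time v)) ∈ S.vis a
  coarse : IsCoarse fun v => seg v (χ (time v))

variable {S}

/-- The map `φ : v ↦ γ_v(χ(T_v))`. -/
def Deformation.φ {a : X} (P : S.Deformation a) (v : X) : S.vis a :=
  ⟨P.seg v (P.χ (P.time v)), P.mem_vis v⟩

end CoarselyConvex

section RadialExtension

variable {X Y : Type*} [MetricSpace X] [MetricSpace Y]
  {SX : CoarselyConvex X} {SY : CoarselyConvex Y} {a : X} {b : Y} {ε : ℝ}

/-- `r` is an admissible `0`-rough contraction for the radial extension of `f`: the map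
`exp ∘ 𝒪f ∘ φ_r` from the open cone over `∂X` to `Y` is coarse, and
`|r(t^ε)^(1/ε) - r(s^ε)^(1/ε)| ≤ |t - s|` whenever `r(t^ε), r(s^ε) ≥ 1`. -/
structure IsAdmissible (hε : 0 < ε) (dX : SX.BoundaryMetric a ε) (exps : SY.ExpChoice b)
    (f : SX.Boundary a → SY.Boundary b) (r : ℝ≥0 → ℝ≥0) : Prop where
  rough : IsRoughContraction 0 r
  coarse : @IsCoarse (OpenCone (SX.Boundary a)) Y (dX.cone hε).toPseudoMetricSpace _
    (exps.exp hε ∘ OpenCone.map f ∘ OpenCone.radial r rough.map_zero)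
  power : ∀ t s : ℝ≥0, 1 ≤ r (t ^ ε) → 1 ≤ r (s ^ ε) →
    dist (r (t ^ ε) ^ (1 / ε)) (r (s ^ ε) ^ (1 / ε)) ≤ dist t s

/-- The radial extension `exp ∘ 𝒪f ∘ φ_r ∘ log ∘ φ` of `f` associated to `r`. -/
def radialExtension (hε : 0 < ε) (P : SX.Deformation a) (logs : SX.LogChoice a)
    (exps : SY.ExpChoice b) (f : SX.Boundary a → SY.Boundary b) (r : ℝ≥0 → ℝ≥0) (hr : r 0 = 0) :
    X → Y :=
  exps.exp hε ∘ OpenCone.map f ∘ OpenCone.radial r hr ∘ logs.log ε ∘ P.φ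

end RadialExtension

end CoarseConvex

end

/-! For a fixed `v`, both radial extensions land on the same ray in `Y`: the representative of the
image under `f` of the class of the ray chosen through `φ v`. Only the parameters on it differ,
namely `powerConj ε r₁` and `powerConj ε r₂` of the time `t` at which that ray passes through `φ v`.
The homotopy slides along this ray at unit speed from one parameter to the other, so `T v` is their
difference.

The content is `coarselyHomotopic_of_rays`. For close `v, w`, the two rays are close at the larger
parameter, because one of the two given maps sits there and is bornologous; convexity (`Ray.convex`)
carries this down to every smaller parameter. Properness holds since the parameter never drops below
the minimum of the two, which is proper in `v`.

Its hypotheses are supplied as follows. The time is bornologous by `theta`-regularity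
(`Ray.dist_param_le`), and `powerConj` is a rough contraction by admissibility
(`dist_powerConj_le`). Each radial extension is coarse as a composition whose remaining factor is
`isCoarse_log`: nearby points at time `t` determine boundary points at distance of order `t^(-ε)`,
which cancels the factor `t^ε` in the cone metric. -/

namespace CoarseConvex

/-! ### Coarse maps through bounds on balls. -/

section CoarseMaps

variable {X Y Z : Type*} [PseudoMetricSpace X] [PseudoMetricSpace Y] [PseudoMetricSpace Z]

theorem isBornologous_iff {f : X → Y} :
    IsBornologous f ↔ ∀ R : ℝ, ∃ M : ℝ, ∀ x x', dist x x' ≤ R → dist (f x) (f x') ≤ M := by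
  constructor
  · rintro ⟨ψ, hψ, h⟩ R
    refine ⟨ψ R.toNNReal, fun x x' hR => ?_⟩
    have h1 : nndist x x' ≤ R.toNNReal := by
      rw [← NNReal.coe_le_coe, coe_nndist]
      exact hR.trans (Real.le_coe_toNNReal R)
    exact_mod_cast (h x x').trans (hψ h1)
  · intro h
    have hbdd : ∀ R : ℝ≥0, BddAbove {m : ℝ≥0 | ∃ x x', nndist x x' ≤ R ∧ nndist (f x) (f x') = m} := by
      intro R
      obtain ⟨M, hM⟩ := h R
      refine ⟨M.toNNReal, ?_⟩
      rintro m ⟨x, x', hR, rfl⟩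
      rw [← NNReal.coe_le_coe, coe_nndist]
      exact (hM x x' (by exact_mod_cast hR)).trans (Real.le_coe_toNNReal M)
    -- The optimal control function: monotone by construction and finite by hypothesis.
    refine ⟨fun R => sSup {m : ℝ≥0 | ∃ x x', nndist x x' ≤ R ∧ nndist (f x) (f x') = m}, ?_, ?_⟩
    · intro R R' hR
      refine csSup_le_csSup' (hbdd R') ?_
      rintro m ⟨x, x', hx, hm⟩
      exact ⟨x, x', hx.trans hR, hm⟩
    · intro x x'
      exact le_csSup (hbdd _) ⟨x, x', le_rfl, rfl⟩

theorem isMetricallyProper_iff {f : X → Y} (a : X) (b : Y) :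
    IsMetricallyProper f ↔ ∀ R : ℝ, ∃ M : ℝ, ∀ x, dist (f x) b ≤ R → dist x a ≤ M := by
  constructor
  · intro h R
    obtain ⟨M, hM⟩ := (Metric.isBounded_iff_subset_closedBall a).1
      (h (Metric.closedBall b R) Metric.isBounded_closedBall)
    exact ⟨M, fun x hx => hM hx⟩
  · intro h B hB
    obtain ⟨R, hR⟩ := (Metric.isBounded_iff_subset_closedBall b).1 hB
    obtain ⟨M, hM⟩ := h R
    exact (Metric.isBounded_iff_subset_closedBall a).2 ⟨M, fun x hx => hM x (hR hx)⟩

theorem IsBornologous.comp {g : Y → Z} {f : X → Y} (hg : IsBornologous g) (hf : IsBornologous f) :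
    IsBornologous (g ∘ f) := by
  obtain ⟨ψ, hψ, h⟩ := hf
  obtain ⟨ψ', hψ', h'⟩ := hg
  exact ⟨ψ' ∘ ψ, hψ'.comp hψ, fun x x' => (h' _ _).trans (hψ' (h x x'))⟩

theorem IsCoarse.comp {g : Y → Z} {f : X → Y} (hg : IsCoarse g) (hf : IsCoarse f) :
    IsCoarse (g ∘ f) :=
  ⟨hg.1.comp hf.1, fun B hB => hf.2 _ (hg.2 B hB)⟩

/-- A coarse map remains coarse when its codomain is restricted to a subspace. -/
theorem IsCoarse.codRestrict {s : Set Y} {f : X → s} (hf : IsCoarse fun x => (f x : Y)) :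
    IsCoarse f := by
  refine ⟨hf.1, fun B hB => ?_⟩
  have h : Bornology.IsBounded ((↑) '' B : Set Y) := Bornology.isBounded_image_subtype_val.2 hB
  exact (hf.2 _ h).subset fun x hx => ⟨f x, hx, rfl⟩

theorem Cylinder.dist_eq {T : X → ℝ≥0} (p q : Cylinder T) :
    dist p q = dist p.1.fst q.1.fst + dist p.1.snd q.1.snd := by
  rw [Subtype.dist_eq, WithLp.prod_dist_eq_add (by norm_num)]
  simp

end CoarseMaps

/-! ### Quasi-geodesic and convexity estimates for rays. -/

namespace CoarselyConvex

variable {X : Type*} [MetricSpace X] (S : CoarselyConvex X)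

theorem k₁_nonneg : 0 ≤ S.k₁ := by
  have := S.one_le_lam
  have := S.k_nonneg
  unfold k₁
  linarith

/-- Shows that the threshold `2 * D + 2` in `rayProd` leaves room for all additive errors in
`exists_mul_le_prod`. -/
theorem four_mul_k₁_add_C_le_D : 4 * S.k₁ + S.C ≤ S.D := by
  have := S.one_le_E
  have := S.k₁_nonneg
  unfold D
  nlinarith

variable {S} {a : X}

theorem Ray.apply_zero (γ : S.Ray a) : γ 0 = a := γ.2.2.2

theorem Ray.apply_floor (γ : S.Ray a) (t : ℝ≥0) : γ (⌊t⌋₊ : ℝ≥0) = γ t := (γ.2.2.1 t).symm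

/-- A ray is a limit of good segments starting at the base point. -/
theorem Ray.exists_approx (γ : S.Ray a) :
    ∃ γs : ℕ → Segment X, (∀ n, γs n ∈ S.segs) ∧ (∀ n, γs n 0 = a) ∧
      Tendsto (fun n => (γs n).len) atTop atTop ∧
      ∀ t : ℝ≥0, Tendsto (fun n => γs n (⌊t⌋₊ : ℝ≥0)) atTop (𝓝 (γ t)) := by
  obtain ⟨γs, h1, h2, h3, h4⟩ := γ.2.1
  refine ⟨γs, h1, fun n => (h2 n).trans γ.apply_zero, h3, fun t => ?_⟩
  rw [← γ.apply_floor t]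
  exact h4 _

theorem dist_floor_le (t : ℝ≥0) : dist ((⌊t⌋₊ : ℝ≥0)) t ≤ 1 := by
  have h1 : ((⌊t⌋₊ : ℝ≥0) : ℝ) ≤ t := by exact_mod_cast Nat.floor_le (zero_le : 0 ≤ t)
  have h2 : (t : ℝ) < (⌊t⌋₊ : ℝ≥0) + 1 := by exact_mod_cast Nat.lt_floor_add_one t
  rw [NNReal.dist_eq, abs_le]
  constructor <;> linarith

theorem dist_floor_floor_le (t s : ℝ≥0) :
    dist ((⌊t⌋₊ : ℝ≥0)) ((⌊s⌋₊ : ℝ≥0)) ≤ dist t s + 1 := by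
  have h1 : ((⌊t⌋₊ : ℝ≥0) : ℝ) ≤ t := by exact_mod_cast Nat.floor_le (zero_le : 0 ≤ t)
  have h2 : (t : ℝ) < (⌊t⌋₊ : ℝ≥0) + 1 := by exact_mod_cast Nat.lt_floor_add_one t
  have h3 : ((⌊s⌋₊ : ℝ≥0) : ℝ) ≤ s := by exact_mod_cast Nat.floor_le (zero_le : 0 ≤ s)
  have h4 : (s : ℝ) < (⌊s⌋₊ : ℝ≥0) + 1 := by exact_mod_cast Nat.lt_floor_add_one s
  have h5 := le_abs_self ((t : ℝ) - s)
  have h6 := neg_abs_le ((t : ℝ) - s)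
  rw [NNReal.dist_eq, NNReal.dist_eq, abs_le]
  constructor <;> linarith

/-- Segments converge to the ray only at integers, so the estimate passes to the limit at floors;
rounding turns `k` into `lam + k = k₁`. -/
theorem Ray.dist_le (γ : S.Ray a) (t s : ℝ≥0) :
    dist (γ t) (γ s) ≤ S.lam * dist t s + S.k₁ := by
  obtain ⟨γs, hmem, -, hlen, hlim⟩ := γ.exists_approx
  have hl := S.one_le_lam
  refine le_of_tendsto ((hlim t).dist (hlim s)) ?_
  filter_upwards [hlen.eventually_ge_atTop (⌊t⌋₊ : ℝ≥0),
    hlen.eventually_ge_atTop (⌊s⌋₊ : ℝ≥0)] with n h1 h2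
  have h3 := (S.quasiGeodesic _ (hmem n) _ _ h1 h2).2
  have h4 := mul_le_mul_of_nonneg_left (dist_floor_floor_le t s) (by linarith : 0 ≤ S.lam)
  unfold k₁
  linarith

theorem Ray.le_dist_base (γ : S.Ray a) (t : ℝ≥0) :
    (t : ℝ) ≤ S.lam * (dist (γ t) a + S.k) + 1 := by
  obtain ⟨γs, hmem, hzero, hlen, hlim⟩ := γ.exists_approx
  have hl := S.one_le_lam
  have h2 : (t : ℝ) < (⌊t⌋₊ : ℝ≥0) + 1 := by exact_mod_cast Nat.lt_floor_add_one t
  refine ge_of_tendsto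
    (((((hlim t).dist tendsto_const_nhds).add_const S.k).const_mul S.lam).add_const 1) ?_
  filter_upwards [hlen.eventually_ge_atTop (⌊t⌋₊ : ℝ≥0)] with n h1
  have h3 := (S.quasiGeodesic _ (hmem n) _ _ h1 zero_le).1
  rw [hzero n, NNReal.dist_eq, NNReal.coe_zero, sub_zero, abs_of_nonneg (NNReal.coe_nonneg _)] at h3
  have h4 := mul_le_mul_of_nonneg_left (sub_le_iff_le_add.1 h3) (by linarith : 0 ≤ S.lam)
  rw [mul_inv_cancel_left₀ (by linarith)] at h4
  linarith

/-- The coarse convexity inequality for rays. -/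
theorem Ray.convex (γ η : S.Ray a) (t s c : ℝ≥0) (hc : c ≤ 1) :
    dist (γ (c * t)) (η (c * s)) ≤ c * S.E * dist (γ t) (η s) + S.C + 2 * S.k₁ := by
  obtain ⟨γs, hmem, hzero, hlen, hlim⟩ := γ.exists_approx
  obtain ⟨ηs, hmem', hzero', hlen', hlim'⟩ := η.exists_approx
  have hl := S.one_le_lam
  -- Convexity of segments compares the parameters `c * ⌊u⌋`, the limit is known at `⌊c * u⌋`. These
  -- differ by at most 1, which costs `k₁` on each of the two segments.
  have key : ∀ u : ℝ≥0, c * ⌊u⌋₊ ≤ ⌊u⌋₊ ∧ dist ((⌊c * u⌋₊ : ℝ≥0)) (c * ⌊u⌋₊) ≤ 1 := by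
    intro u
    refine ⟨mul_le_of_le_one_left zero_le hc, ?_⟩
    have hc' : (c : ℝ) ≤ 1 := by exact_mod_cast hc
    have h1 : ((⌊u⌋₊ : ℝ≥0) : ℝ) ≤ u := by exact_mod_cast Nat.floor_le (zero_le : 0 ≤ u)
    have h2 : (u : ℝ) < (⌊u⌋₊ : ℝ≥0) + 1 := by exact_mod_cast Nat.lt_floor_add_one u
    have h3 : ((⌊c * u⌋₊ : ℝ≥0) : ℝ) ≤ c * u := by
      exact_mod_cast Nat.floor_le (zero_le : 0 ≤ c * u)
    have h4 : (c * u : ℝ) < (⌊c * u⌋₊ : ℝ≥0) + 1 := by exact_mod_cast Nat.lt_floor_add_one (c * u)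
    have h5 := mul_le_mul_of_nonneg_left h1 c.coe_nonneg
    have h6 := mul_le_mul_of_nonneg_left h2.le c.coe_nonneg
    rw [NNReal.dist_eq, NNReal.coe_mul, abs_le]
    constructor <;> linarith
  refine le_of_tendsto_of_tendsto ((hlim (c * t)).dist (hlim' (c * s)))
    (((((hlim t).dist (hlim' s)).const_mul _).add_const _).add_const _) ?_
  filter_upwards [hlen.eventually_ge_atTop (⌊t⌋₊ : ℝ≥0),
    hlen'.eventually_ge_atTop (⌊s⌋₊ : ℝ≥0), hlen.eventually_ge_atTop (⌊c * t⌋₊ : ℝ≥0),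
    hlen'.eventually_ge_atTop (⌊c * s⌋₊ : ℝ≥0)] with n h1 h2 h3 h4
  have e1 := S.convex _ (hmem n) _ (hmem' n) _ _ c h1 h2 hc
  rw [hzero n, hzero' n, dist_self, mul_zero, add_zero] at e1
  have e2 := (S.quasiGeodesic _ (hmem n) _ _ h3 ((key t).1.trans h1)).2
  have e3 := (S.quasiGeodesic _ (hmem' n) _ _ h4 ((key s).1.trans h2)).2
  have e4 := mul_le_mul_of_nonneg_left (key t).2 (by linarith : 0 ≤ S.lam)
  have e5 := mul_le_mul_of_nonneg_left (key s).2 (by linarith : 0 ≤ S.lam)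
  have e6 := dist_triangle4 (γs n (⌊c * t⌋₊ : ℝ≥0)) (γs n (c * ⌊t⌋₊)) (ηs n (c * ⌊s⌋₊))
    (ηs n (⌊c * s⌋₊ : ℝ≥0))
  rw [dist_comm (ηs n (c * ⌊s⌋₊))] at e6
  have e7 : S.k₁ = S.lam + S.k := rfl
  linarith

/-- The parameters of two points on rays are close if the points are. -/
theorem Ray.dist_param_le (γ η : S.Ray a) (t s : ℝ≥0) :
    dist t s ≤ S.theta (nndist (γ t) (η s) + 1) + 2 := by
  obtain ⟨γs, hmem, hzero, hlen, hlim⟩ := γ.exists_approx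
  obtain ⟨ηs, hmem', hzero', hlen', hlim'⟩ := η.exists_approx
  -- `theta` need not be continuous, so the slack 1 lets its monotonicity act on a single far
  -- approximant; the final `+ 2` pays for the two floors.
  have hlt : nndist (γ t) (η s) < nndist (γ t) (η s) + 1 := lt_add_one _
  obtain ⟨n, h1, h2, h3⟩ := ((hlen.eventually_ge_atTop (⌊t⌋₊ : ℝ≥0)).and
    ((hlen'.eventually_ge_atTop (⌊s⌋₊ : ℝ≥0)).and
      (((hlim t).nndist (hlim' s)).eventually_lt_const hlt))).exists
  have h4 := S.param_reg _ (hmem n) _ (hmem' n) _ _ h1 h2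
  rw [hzero n, hzero' n, nndist_self, zero_add] at h4
  have h5 : dist ((⌊t⌋₊ : ℝ≥0)) ((⌊s⌋₊ : ℝ≥0)) ≤ S.theta (nndist (γ t) (η s) + 1) :=
    (coe_nndist ((⌊t⌋₊ : ℝ≥0)) (⌊s⌋₊ : ℝ≥0)).symm.trans_le
      (NNReal.coe_le_coe.2 (h4.trans (S.theta_mono h3.le)))
  have h6 := dist_triangle4 t (⌊t⌋₊ : ℝ≥0) (⌊s⌋₊ : ℝ≥0) s
  have h7 := dist_floor_le t
  have h8 := dist_floor_le s
  rw [dist_comm] at h7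
  linarith

/-- If `γ t` and `η s` are at distance at most `R`, then the boundary points of `γ` and `η` have
product at least a definite multiple of `t`. -/
theorem exists_mul_le_prod (S : CoarselyConvex X) (a : X) (R : ℝ) :
    ∃ c : ℝ≥0, 0 < c ∧ ∀ (γ η : S.Ray a) (t s : ℝ≥0), dist (γ t) (η s) ≤ R →
      ((c * t : ℝ≥0) : ℝ≥0∞) ≤ S.prod γ.toBoundary η.toBoundary := by
  have hl := S.one_le_lam
  have hE := S.one_le_E
  have hC := S.C_nonneg
  have hk := S.k₁_nonneg
  have hD := S.four_mul_k₁_add_C_le_D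
  set A : ℝ≥0 := S.theta (R.toNNReal + 1) + 2 with hA
  -- `B` is chosen so that scaling by `B⁻¹` makes the distance term `E * R` and the parameter shift
  -- `lam * A` contribute at most 1 together.
  obtain ⟨B, hB⟩ : ∃ B : ℝ≥0, (B : ℝ) = S.E * R.toNNReal + S.lam * A + 1 :=
    ⟨⟨_, by positivity⟩, rfl⟩
  have hB1 : (1 : ℝ) ≤ B := by
    rw [hB]
    have : 0 ≤ S.E * R.toNNReal := by positivity
    have : 0 ≤ S.lam * A := by positivity
    linarith
  have hB0 : (0 : ℝ) < B := by linarith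
  refine ⟨B⁻¹, inv_pos.2 (by exact_mod_cast hB0), fun γ η t s hR => ?_⟩
  have hc1 : B⁻¹ ≤ 1 := inv_le_one_of_one_le₀ (by exact_mod_cast hB1)
  have hRn : dist (γ t) (η s) ≤ R.toNNReal := hR.trans (Real.le_coe_toNNReal R)
  have hts : dist t s ≤ A := by
    refine (γ.dist_param_le η t s).trans ?_
    rw [hA, NNReal.coe_add]
    have h : nndist (γ t) (η s) ≤ R.toNNReal := by exact_mod_cast hRn
    exact add_le_add (NNReal.coe_le_coe.2 (S.theta_mono (add_le_add_left h 1))) le_rfl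
  refine le_trans ?_ (le_iSup_of_le γ (le_iSup_of_le η (le_iSup_of_le rfl
    (le_iSup_of_le rfl le_rfl))))
  refine le_iSup_of_le (B⁻¹ * t) (le_iSup_of_le ?_ le_rfl)
  have e1 := γ.convex η t s B⁻¹ hc1
  have e2 := η.dist_le (B⁻¹ * s) (B⁻¹ * t)
  have e3 : dist (B⁻¹ * s) (B⁻¹ * t) = (B : ℝ)⁻¹ * dist t s := by
    rw [dist_comm, NNReal.dist_eq, NNReal.dist_eq, NNReal.coe_mul, NNReal.coe_mul, ← mul_sub,
      abs_mul, NNReal.coe_inv, abs_of_pos (inv_pos.2 hB0)]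
  rw [e3] at e2
  rw [NNReal.coe_inv] at e1
  have e4 := dist_triangle (γ (B⁻¹ * t)) (η (B⁻¹ * s)) (η (B⁻¹ * t))
  have e5 : (B : ℝ)⁻¹ * S.E * dist (γ t) (η s) + S.lam * ((B : ℝ)⁻¹ * dist t s) ≤ 1 := by
    have h1 : S.E * dist (γ t) (η s) ≤ S.E * R.toNNReal := by gcongr
    have h2 : S.lam * dist t s ≤ S.lam * A := by gcongr
    calc (B : ℝ)⁻¹ * S.E * dist (γ t) (η s) + S.lam * ((B : ℝ)⁻¹ * dist t s)
        = (B : ℝ)⁻¹ * (S.E * dist (γ t) (η s) + S.lam * dist t s) := by ring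
      _ ≤ (B : ℝ)⁻¹ * B := by
          apply mul_le_mul_of_nonneg_left _ (inv_nonneg.2 hB0.le)
          linarith
      _ = 1 := inv_mul_cancel₀ hB0.ne'
  linarith

/-! ### Coarseness of the logarithm. -/

theorem dist_rpow_le {ε : ℝ} (hε : 0 ≤ ε) (hε1 : ε ≤ 1) (t s A : ℝ≥0) (h : dist t s ≤ A) :
    dist (t ^ ε) (s ^ ε) ≤ (A ^ ε : ℝ≥0) := by
  have key : ∀ t s : ℝ≥0, dist t s ≤ A → ((t ^ ε : ℝ≥0) : ℝ) ≤ (s ^ ε : ℝ≥0) + (A ^ ε : ℝ≥0) := by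
    intro t s h
    have h1 : t ≤ s + A := by
      rw [← NNReal.coe_le_coe, NNReal.coe_add]
      rw [NNReal.dist_eq] at h
      linarith [le_abs_self ((t : ℝ) - s)]
    -- Subadditivity of the power `ε ≤ 1`.
    exact_mod_cast (NNReal.rpow_le_rpow h1 hε).trans (NNReal.rpow_add_le_add_rpow s A hε hε1)
  have h1 := key t s h
  have h2 := key s t (by rwa [dist_comm])
  rw [NNReal.dist_eq, abs_le]
  constructor <;> linarith

/-- The logarithmic map is coarse. -/
theorem LogChoice.isCoarse_log {ε : ℝ} (hε : 0 < ε) (hε1 : ε ≤ 1) (M : S.BoundaryMetric a ε)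
    (c : S.LogChoice a) (o : S.vis a) :
    @IsCoarse _ _ _ (M.cone hε).toPseudoMetricSpace (c.log ε) := by
  let := M.cone hε
  constructor
  · rw [isBornologous_iff]
    intro R
    obtain ⟨κ, hκ, hprod⟩ := exists_mul_le_prod S a R
    refine ⟨((S.theta (R.toNNReal + 1) + 2 : ℝ≥0) ^ ε : ℝ≥0) + ((κ ^ ε)⁻¹ : ℝ≥0), fun v w hvw => ?_⟩
    change |((c.time v ^ ε : ℝ≥0) : ℝ) - (c.time w ^ ε : ℝ≥0)| +
      min ((c.time v ^ ε : ℝ≥0) : ℝ) (c.time w ^ ε : ℝ≥0) *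
        M.metric.dist (c.ray v).toBoundary (c.ray w).toBoundary ≤ _
    have hd : dist (c.ray v (c.time v)) (c.ray w (c.time w)) ≤ R := by
      rw [c.ray_time, c.ray_time]; exact hvw
    refine add_le_add ?_ ?_
    · rw [← NNReal.dist_eq]
      refine dist_rpow_le hε.le hε1 _ _ _ (((c.ray v).dist_param_le (c.ray w) _ _).trans ?_)
      rw [NNReal.coe_add]
      refine add_le_add (NNReal.coe_le_coe.2 (S.theta_mono (add_le_add_left ?_ 1))) le_rfl
      rw [← NNReal.coe_le_coe, coe_nndist]
      exact hd.trans (Real.le_coe_toNNReal R)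
    · set t := c.time v
      have hnn : 0 ≤ M.metric.dist (c.ray v).toBoundary (c.ray w).toBoundary :=
        @dist_nonneg _ M.metric.toPseudoMetricSpace _ _
      refine (mul_le_mul_of_nonneg_right (min_le_left _ _) hnn).trans ?_
      -- At the cone point the factor `t ^ ε` vanishes; elsewhere it cancels against `(κ * t)^(-ε)`.
      rcases eq_or_ne t 0 with ht | ht
      · rw [ht, NNReal.zero_rpow hε.ne', NNReal.coe_zero, zero_mul]
        exact NNReal.coe_nonneg _
      · have h1 := M.upper (c.ray v).toBoundary (c.ray w).toBoundary
        have h2 : S.prod (c.ray v).toBoundary (c.ray w).toBoundary ^ (-ε) ≤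
            (((κ * t) ^ ε)⁻¹ : ℝ≥0) := by
          have hpos : κ * t ≠ 0 := mul_ne_zero hκ.ne' ht
          rw [ENNReal.rpow_neg, ENNReal.coe_inv (by simp [NNReal.rpow_eq_zero_iff, hpos]),
            ENNReal.inv_le_inv, ENNReal.coe_rpow_of_nonneg _ hε.le]
          exact ENNReal.rpow_le_rpow (hprod _ _ _ _ hd) hε.le
        have h3 : M.metric.dist (c.ray v).toBoundary (c.ray w).toBoundary ≤
            (((κ * t) ^ ε)⁻¹ : ℝ≥0) := by
          have := h1.trans h2
          rw [← ENNReal.ofReal_coe_nnreal] at this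
          exact (ENNReal.ofReal_le_ofReal_iff (NNReal.coe_nonneg _)).1 this
        refine (mul_le_mul_of_nonneg_left h3 (NNReal.coe_nonneg _)).trans_eq ?_
        rw [← NNReal.coe_mul, NNReal.mul_rpow, mul_inv, mul_comm, mul_assoc,
          inv_mul_cancel₀ (by simp [NNReal.rpow_eq_zero_iff, ht]), mul_one]
  · rw [isMetricallyProper_iff o (c.log ε o)]
    intro R
    -- The cone distance dominates the difference of radial coordinates, so it bounds the time of
    -- `v` and hence the distance from `v` to `a`.
    set s := c.time o ^ ε
    refine ⟨S.lam * ((R.toNNReal + s) ^ (1 / ε) : ℝ≥0) + S.k₁ + dist a o, fun v hv => ?_⟩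
    have hl := S.one_le_lam
    change |((c.time v ^ ε : ℝ≥0) : ℝ) - s| + min ((c.time v ^ ε : ℝ≥0) : ℝ) s *
        M.metric.dist (c.ray v).toBoundary (c.ray o).toBoundary ≤ R at hv
    have hnn : 0 ≤ M.metric.dist (c.ray v).toBoundary (c.ray o).toBoundary :=
      @dist_nonneg _ M.metric.toPseudoMetricSpace _ _
    have h0 : 0 ≤ min ((c.time v ^ ε : ℝ≥0) : ℝ) s *
        M.metric.dist (c.ray v).toBoundary (c.ray o).toBoundary :=
      mul_nonneg (le_min (NNReal.coe_nonneg _) (NNReal.coe_nonneg _)) hnn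
    have h1 : c.time v ^ ε ≤ R.toNNReal + s := by
      rw [← NNReal.coe_le_coe, NNReal.coe_add]
      linarith [le_abs_self (((c.time v ^ ε : ℝ≥0) : ℝ) - s), Real.le_coe_toNNReal R]
    have h2 : c.time v ≤ (R.toNNReal + s) ^ (1 / ε) := by
      have := NNReal.rpow_le_rpow h1 (one_div_pos.2 hε).le
      rwa [NNReal.rpow_inv_rpow_self hε.ne'] at this
    have h3 := (c.ray v).dist_le (c.time v) 0
    rw [c.ray_time, Ray.apply_zero, NNReal.dist_eq, NNReal.coe_zero, sub_zero,
      abs_of_nonneg (NNReal.coe_nonneg _)] at h3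
    have h4 := mul_le_mul_of_nonneg_left (NNReal.coe_le_coe.2 h2) (by linarith : 0 ≤ S.lam)
    have h5 := dist_triangle (v : X) a o
    change dist (v : X) o ≤ _
    linarith

theorem Deformation.isCoarse_φ (P : S.Deformation a) : IsCoarse P.φ :=
  IsCoarse.codRestrict P.coarse

end CoarselyConvex

end CoarseConvex
-- Motion between parameters, and the contraction acting on ray parameters.
namespace CoarseConvex

/-- The point reached from `p` by moving towards `q` by `t`, and stopping at `q`. -/
def moveTowards (p q t : ℝ≥0) : ℝ≥0 := max (p - t) (min (p + t) q)

/-- Truncated subtraction is harmless here because the other argument of `max` is nonnegative. -/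
theorem coe_moveTowards (p q t : ℝ≥0) :
    (moveTowards p q t : ℝ) = max ((p : ℝ) - t) (min ((p : ℝ) + t) q) := by
  rw [moveTowards, NNReal.coe_max, NNReal.coe_min, NNReal.coe_add, NNReal.coe_sub_def,
    max_assoc, max_eq_right (a := (0 : ℝ)) (le_min (add_nonneg p.coe_nonneg t.coe_nonneg) q.coe_nonneg)]

theorem moveTowards_zero (p q : ℝ≥0) : moveTowards p q 0 = p := by
  rw [moveTowards, tsub_zero, add_zero]
  exact max_eq_left (min_le_left _ _)

theorem moveTowards_nndist (p q : ℝ≥0) : moveTowards p q (nndist p q) = q := by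
  apply NNReal.coe_injective
  rw [coe_moveTowards, coe_nndist, NNReal.dist_eq]
  rw [min_eq_right (by linarith [neg_abs_le ((p : ℝ) - q)]),
    max_eq_right (by linarith [le_abs_self ((p : ℝ) - q)])]

theorem moveTowards_le_max (p q t : ℝ≥0) : moveTowards p q t ≤ max p q :=
  max_le_max tsub_le_self (min_le_right _ _)

theorem min_le_moveTowards (p q t : ℝ≥0) : min p q ≤ moveTowards p q t :=
  le_max_of_le_right (min_le_min_right _ le_self_add)

theorem dist_moveTowards_le (p q t p' q' t' : ℝ≥0) :
    dist (moveTowards p q t) (moveTowards p' q' t') ≤ dist p p' + dist q q' + dist t t' := by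
  simp only [NNReal.dist_eq, coe_moveTowards]
  have h1 := abs_max_sub_max_le_max ((p : ℝ) - t) (min ((p : ℝ) + t) q) ((p' : ℝ) - t')
    (min ((p' : ℝ) + t') q')
  have h2 := abs_min_sub_min_le_max ((p : ℝ) + t) q ((p' : ℝ) + t') q'
  have h3 : |((p : ℝ) - t) - (p' - t')| ≤ |(p : ℝ) - p'| + |(t : ℝ) - t'| := by
    rw [show ((p : ℝ) - t) - (p' - t') = (p - p') - (t - t') by ring]
    exact abs_sub _ _
  have h4 : |((p : ℝ) + t) - (p' + t')| ≤ |(p : ℝ) - p'| + |(t : ℝ) - t'| := by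
    rw [show ((p : ℝ) + t) - (p' + t') = (p - p') + (t - t') by ring]
    exact abs_add_le _ _
  have h5 := abs_nonneg ((q : ℝ) - q')
  have h6 := abs_nonneg ((p : ℝ) - p')
  have h7 := abs_nonneg ((t : ℝ) - t')
  refine h1.trans (max_le (by linarith) (h2.trans (max_le (by linarith) (by linarith))))

/-- The self-map `t ↦ r(t^ε)^(1/ε)` of `ℝ≥0` induced by `r` on the parameters of rays. -/
noncomputable def powerConj (ε : ℝ) (r : ℝ≥0 → ℝ≥0) (t : ℝ≥0) : ℝ≥0 := r (t ^ ε) ^ (1 / ε)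

section PowerConj

variable {ε : ℝ} {r : ℝ≥0 → ℝ≥0}

theorem IsRoughContraction.continuous (hr : IsRoughContraction 0 r) : Continuous r := by
  refine (LipschitzWith.of_dist_le_mul (K := 1) fun t s => ?_).continuous
  have := hr.dist_le t s
  simpa using this

theorem powerConj_mono (hε : 0 < ε) (hr : IsRoughContraction 0 r) : Monotone (powerConj ε r) :=
  fun _ _ h => NNReal.rpow_le_rpow (hr.mono (NNReal.rpow_le_rpow h hε.le)) (one_div_pos.2 hε).le

/-- Admissibility controls only the region `r ≥ 1`; on the rest the values of `powerConj` lie in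
`[0, 1]`, which the additive 1 absorbs. -/
theorem dist_powerConj_le (hε : 0 < ε) (hr : IsRoughContraction 0 r)
    (hpow : ∀ t s : ℝ≥0, 1 ≤ r (t ^ ε) → 1 ≤ r (s ^ ε) →
      dist (r (t ^ ε) ^ (1 / ε)) (r (s ^ ε) ^ (1 / ε)) ≤ dist t s) (t s : ℝ≥0) :
    dist (powerConj ε r t) (powerConj ε r s) ≤ dist t s + 1 := by
  wlog hst : s ≤ t generalizing t s
  · rw [dist_comm, dist_comm t s]
    exact this s t (le_of_not_ge hst)
  have hmono := powerConj_mono hε hr hst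
  have hsmall : ∀ u, r (u ^ ε) ≤ 1 → powerConj ε r u ≤ 1 := fun u hu =>
    NNReal.rpow_le_one hu (one_div_pos.2 hε).le
  have hd : dist (powerConj ε r t) (powerConj ε r s) =
      (powerConj ε r t : ℝ) - powerConj ε r s := by
    rw [NNReal.dist_eq, abs_of_nonneg (sub_nonneg.2 (NNReal.coe_le_coe.2 hmono))]
  rcases le_total (r (t ^ ε)) 1 with ht | ht
  · have h1 : (powerConj ε r t : ℝ) ≤ 1 := by exact_mod_cast hsmall t ht
    rw [hd]
    linarith [(powerConj ε r s).coe_nonneg, dist_nonneg (x := t) (y := s)]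
  rcases le_total (r (s ^ ε)) 1 with hs | hs
  -- In the mixed case, split at an intermediate `u` where `r (u ^ ε) = 1`: admissibility applies on
  -- `[u, t]`, and the value at `u` is at most 1.
  · have hcont : Continuous fun u : ℝ≥0 => r (u ^ ε) :=
      hr.continuous.comp (NNReal.continuous_rpow_const hε.le)
    obtain ⟨u, ⟨hu1, hu2⟩, hu⟩ := intermediate_value_Icc hst hcont.continuousOn ⟨hs, ht⟩
    dsimp only at hu
    have h1 := hpow t u ht hu.ge
    have h2 : (powerConj ε r u : ℝ) ≤ 1 := by exact_mod_cast hsmall u hu.le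
    have h3 := (le_abs_self _).trans ((NNReal.dist_eq _ _).symm.trans_le h1)
    have h4 : dist t u ≤ dist t s := by
      rw [NNReal.dist_eq, NNReal.dist_eq, abs_of_nonneg (sub_nonneg.2 (NNReal.coe_le_coe.2 hu2)),
        abs_of_nonneg (sub_nonneg.2 (NNReal.coe_le_coe.2 hst))]
      exact sub_le_sub_left (NNReal.coe_le_coe.2 hu1) _
    have h5 : (powerConj ε r t : ℝ) - powerConj ε r u ≤ dist t u := h3
    rw [hd]
    linarith [(powerConj ε r s).coe_nonneg]
  · linarith [hpow t s ht hs, show dist (powerConj ε r t) (powerConj ε r s) =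
      dist (r (t ^ ε) ^ (1 / ε)) (r (s ^ ε) ^ (1 / ε)) from rfl]

theorem tendsto_powerConj (hε : 0 < ε) (hr : IsRoughContraction 0 r) :
    Tendsto (powerConj ε r) atTop atTop :=
  (NNReal.tendsto_rpow_atTop (one_div_pos.2 hε)).comp
    (hr.tendsto.comp (NNReal.tendsto_rpow_atTop hε))

end PowerConj

/-! ### Homotopy along rays, and its hypotheses for radial extensions. -/

section RadialExtension

variable {X Y : Type*} [MetricSpace X] [MetricSpace Y]
  {SX : CoarselyConvex X} {SY : CoarselyConvex Y} {a : X} {b : Y} {ε : ℝ}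

/-- Radial extensions are coarse maps. -/
theorem IsAdmissible.isCoarse_radialExtension {hε : 0 < ε} (hε1 : ε ≤ 1)
    {dX : SX.BoundaryMetric a ε} {exps : SY.ExpChoice b} {f : SX.Boundary a → SY.Boundary b}
    {r : ℝ≥0 → ℝ≥0} (h : IsAdmissible hε dX exps f r) (P : SX.Deformation a)
    (logs : SX.LogChoice a) :
    IsCoarse (radialExtension hε P logs exps f r h.rough.map_zero) := by
  let := dX.cone hε
  exact h.coarse.comp ((logs.isCoarse_log hε hε1 dX (P.φ a)).comp P.isCoarse_φ)

/-- Moving along rays between two coarse maps gives a coarse homotopy, provided that the parameters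
of both maps are bornologous and the smaller one is proper. -/
theorem coarselyHomotopic_of_rays {Z : Type*} [PseudoMetricSpace Z] (o : Z) (η : Z → SY.Ray b)
    (p q : Z → ℝ≥0) (hp : IsBornologous p) (hq : IsBornologous q)
    (hf : IsCoarse fun v => η v (p v)) (hg : IsCoarse fun v => η v (q v))
    (hpq : IsMetricallyProper fun v => min (p v) (q v)) :
    CoarselyHomotopic (fun v => η v (p v)) (fun v => η v (q v)) := by
  have hl := SY.one_le_lam
  have hE := SY.one_le_E
  have hpb := isBornologous_iff.1 hp
  have hqb := isBornologous_iff.1 hq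
  refine ⟨hf, hg, fun v => nndist (p v) (q v),
    fun z => η z.1.fst (moveTowards (p z.1.fst) (q z.1.fst) z.1.snd), ?_, ⟨?_, ?_⟩, ?_, ?_⟩
  · rw [isBornologous_iff]
    intro R
    obtain ⟨A, hA⟩ := hpb R
    obtain ⟨B, hB⟩ := hqb R
    refine ⟨A + B, fun v w hvw => ?_⟩
    have h1 := dist_dist_dist_le (p v) (q v) (p w) (q w)
    rw [NNReal.dist_eq, coe_nndist, coe_nndist, ← Real.dist_eq]
    linarith [hA v w hvw, hB v w hvw]
  · rw [isBornologous_iff]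
    intro R
    obtain ⟨A, hA⟩ := hpb R
    obtain ⟨B, hB⟩ := hqb R
    obtain ⟨F, hF⟩ := isBornologous_iff.1 hf.1 R
    obtain ⟨G, hG⟩ := isBornologous_iff.1 hg.1 R
    refine ⟨SY.E * (max (F + (SY.lam * A + SY.k₁)) (G + (SY.lam * B + SY.k₁))) + SY.C + 2 * SY.k₁ +
      (SY.lam * (A + B + R) + SY.k₁), ?_⟩
    rintro ⟨z, hz⟩ ⟨z', hz'⟩ hR
    rw [Cylinder.dist_eq (T := fun v => nndist (p v) (q v))] at hR
    dsimp only at hR hz hz' ⊢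
    generalize z.fst = v, z.snd = t, z'.fst = w, z'.snd = s at *
    have hvw : dist v w ≤ R := by linarith [dist_nonneg (x := t) (y := s)]
    have hts : dist t s ≤ R := by linarith [dist_nonneg (x := v) (y := w)]
    set u := moveTowards (p v) (q v) t with hu
    set u' := moveTowards (p w) (q w) s with hu'
    have huu : dist u u' ≤ A + B + R :=
      (dist_moveTowards_le _ _ _ _ _ _).trans (by linarith [hA v w hvw, hB v w hvw])
    -- Convexity needs a common parameter on both rays; replacing `p w` by `p v` costs `lam * A +
    -- k₁`.
    have h1 : dist (η v (p v)) (η w (p v)) ≤ F + (SY.lam * A + SY.k₁) := by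
      refine (dist_triangle _ (η w (p w)) _).trans (add_le_add (hF v w hvw)
        (((η w).dist_le _ _).trans ?_))
      have : dist (p w) (p v) ≤ A := by rw [dist_comm]; exact hA v w hvw
      gcongr
    have h2 : dist (η v (q v)) (η w (q v)) ≤ G + (SY.lam * B + SY.k₁) := by
      refine (dist_triangle _ (η w (q w)) _).trans (add_le_add (hG v w hvw)
        (((η w).dist_le _ _).trans ?_))
      have : dist (q w) (q v) ≤ B := by rw [dist_comm]; exact hB v w hvw
      gcongr
    have h3 : dist (η v (max (p v) (q v))) (η w (max (p v) (q v))) ≤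
        max (F + (SY.lam * A + SY.k₁)) (G + (SY.lam * B + SY.k₁)) := by
      rcases le_total (p v) (q v) with h | h
      · rw [max_eq_right h]; exact le_max_of_le_right h2
      · rw [max_eq_left h]; exact le_max_of_le_left h1
    set H := max (F + (SY.lam * A + SY.k₁)) (G + (SY.lam * B + SY.k₁))
    set m := max (p v) (q v)
    have h4 : dist (η v u) (η w u) ≤ SY.E * H + SY.C + 2 * SY.k₁ := by
      -- The moving parameter stays below `m`, so it is a fraction of `m` and convexity from the
      -- common base point applies.
      obtain ⟨c, hc, hcu⟩ : ∃ c : ℝ≥0, c ≤ 1 ∧ u = c * m := by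
        have hum : u ≤ m := moveTowards_le_max _ _ _
        rcases eq_or_ne m 0 with hm | hm
        · exact ⟨0, zero_le_one, by rw [hm] at hum ⊢; simpa using hum⟩
        · exact ⟨u / m, div_le_one_of_le₀ hum zero_le, (div_mul_cancel₀ u hm).symm⟩
      rw [hcu]
      refine ((η v).convex (η w) m m c hc).trans ?_
      have h5 : c * SY.E * dist (η v m) (η w m) ≤ SY.E * H := by
        have hc' : (c : ℝ) ≤ 1 := by exact_mod_cast hc
        have h6 : (c : ℝ) * SY.E ≤ SY.E := mul_le_of_le_one_left (by linarith) hc'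
        exact mul_le_mul h6 h3 dist_nonneg (by linarith)
      linarith
    refine (dist_triangle _ (η w u) _).trans (add_le_add h4 (((η w).dist_le _ _).trans ?_))
    gcongr
  · rw [isMetricallyProper_iff (Cylinder.mk o 0 zero_le) b]
    intro R
    -- The radius is the bound of `le_dist_base` for ray points within `R` of `b`. It confines `v`,
    -- and then `t` through `T v`.
    obtain ⟨M, hM⟩ := (isMetricallyProper_iff o (0 : ℝ≥0)).1 hpq (SY.lam * (R + SY.k) + 1)
    obtain ⟨A, hA⟩ := hpb M
    obtain ⟨B, hB⟩ := hqb M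
    refine ⟨M + (A + dist (p o) (q o) + B), ?_⟩
    rintro ⟨z, hz⟩ hR
    rw [Cylinder.dist_eq (T := fun v => nndist (p v) (q v))]
    change dist z.fst o + dist z.snd 0 ≤ _
    dsimp only at hR hz
    generalize z.fst = v, z.snd = t at *
    have h1 := (η v).le_dist_base (moveTowards (p v) (q v) t)
    have h2 : (min (p v) (q v) : ℝ≥0) ≤ SY.lam * (R + SY.k) + 1 := by
      refine (NNReal.coe_le_coe.2 (min_le_moveTowards (p v) (q v) t)).trans (h1.trans ?_)
      gcongr
    have h3 : dist v o ≤ M := by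
      refine hM v ?_
      rw [NNReal.dist_eq, NNReal.coe_zero, sub_zero, abs_of_nonneg (NNReal.coe_nonneg _)]
      exact h2
    have h4 : (t : ℝ) ≤ dist (p v) (q v) := by
      rw [← coe_nndist]; exact_mod_cast hz
    have h5 := dist_triangle4 (p v) (p o) (q o) (q v)
    have h6 := hB v o h3
    rw [dist_comm] at h6
    rw [NNReal.dist_eq t, NNReal.coe_zero, sub_zero, abs_of_nonneg t.coe_nonneg]
    linarith [hA v o h3]
  · intro v
    exact congrArg (η v) (moveTowards_zero _ _)
  · intro v
    exact congrArg (η v) (moveTowards_nndist _ _)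

/-- The parameters of the rays through the points `φ v` depend bornologously on `v`. -/
theorem CoarselyConvex.Deformation.isBornologous_time (P : SX.Deformation a)
    (logs : SX.LogChoice a) : IsBornologous fun v => logs.time (P.φ v) := by
  refine IsBornologous.comp (g := logs.time) ⟨fun R => SX.theta (R + 1) + 2, ?_, fun v w => ?_⟩
    P.isCoarse_φ.1
  · intro R R' h
    exact add_le_add_left (SX.theta_mono (add_le_add_left h 1)) 2
  · have h := (logs.ray v).dist_param_le (logs.ray w) (logs.time v) (logs.time w)
    rw [logs.ray_time, logs.ray_time] at h
    exact_mod_cast h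

theorem IsAdmissible.isBornologous_powerConj {hε : 0 < ε} {dX : SX.BoundaryMetric a ε}
    {exps : SY.ExpChoice b} {f : SX.Boundary a → SY.Boundary b} {r : ℝ≥0 → ℝ≥0}
    (h : IsAdmissible hε dX exps f r) : IsBornologous (powerConj ε r) :=
  ⟨fun R => R + 1, fun _ _ hR => add_le_add_left hR 1, fun t s => by
    exact_mod_cast dist_powerConj_le hε h.rough h.power t s⟩

/-- A point is bounded by the parameter of its image under the deformation. -/
theorem CoarselyConvex.Deformation.isMetricallyProper_time (P : SX.Deformation a)
    (logs : SX.LogChoice a) : IsMetricallyProper fun v => logs.time (P.φ v) := by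
  have h : IsMetricallyProper logs.time := by
    rw [isMetricallyProper_iff (P.φ a) (0 : ℝ≥0)]
    intro R
    refine ⟨SX.lam * R + SX.k₁ + dist a (P.φ a), fun v hv => ?_⟩
    have hl := SX.one_le_lam
    have h3 := (logs.ray v).dist_le (logs.time v) 0
    rw [logs.ray_time, Ray.apply_zero] at h3
    have h4 := mul_le_mul_of_nonneg_left hv (by linarith : 0 ≤ SX.lam)
    have h5 := dist_triangle (v : X) a (P.φ a)
    change dist (v : X) (P.φ a) ≤ _
    linarith
  exact fun B hB => P.isCoarse_φ.2 _ (h B hB)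

end RadialExtension

end CoarseConvex

theorem proposition6
    {X Y : Type*} [MetricSpace X] [ProperSpace X] [MetricSpace Y] [ProperSpace Y]
    (SX : CoarseConvex.CoarselyConvex X) (SY : CoarseConvex.CoarselyConvex Y) (a : X) (b : Y)
    (ε : ℝ) (hε : 0 < ε) (_hε1 : ε < 1)
    (dX : SX.BoundaryMetric a ε) (_dY : SY.BoundaryMetric b ε)
    (P : SX.Deformation a) (logs : SX.LogChoice a) (exps : SY.ExpChoice b)
    (f : SX.Boundary a → SY.Boundary b) (_hf : Continuous f)
    (r₁ r₂ : ℝ≥0 → ℝ≥0)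
    (h₁ : CoarseConvex.IsAdmissible hε dX exps f r₁)
    (h₂ : CoarseConvex.IsAdmissible hε dX exps f r₂) :
    CoarseConvex.CoarselyHomotopic
      (CoarseConvex.radialExtension hε P logs exps f r₁ h₁.rough.map_zero)
      (CoarseConvex.radialExtension hε P logs exps f r₂ h₂.rough.map_zero) := by
  -- Both radial extensions unfold definitionally to evaluations of this family of rays.
  refine CoarseConvex.coarselyHomotopic_of_rays a
    (fun v => exps.ray (f (logs.ray (P.φ v)).toBoundary))
    (fun v => CoarseConvex.powerConj ε r₁ (logs.time (P.φ v)))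
    (fun v => CoarseConvex.powerConj ε r₂ (logs.time (P.φ v)))
    (h₁.isBornologous_powerConj.comp (P.isBornologous_time logs))
    (h₂.isBornologous_powerConj.comp (P.isBornologous_time logs))
    (h₁.isCoarse_radialExtension _hε1.le P logs) (h₂.isCoarse_radialExtension _hε1.le P logs)
    fun B hB => P.isMetricallyProper_time logs
      ((fun t => min (CoarseConvex.powerConj ε r₁ t) (CoarseConvex.powerConj ε r₂ t)) ⁻¹' B) ?_
  -- Both parameters tend to infinity with the time, so a bounded minimum forces a bounded time.
  have htend : Tendsto
      (fun t => min (CoarseConvex.powerConj ε r₁ t) (CoarseConvex.powerConj ε r₂ t))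
      atTop atTop :=
    tendsto_atTop.2 fun M => by
      filter_upwards [(CoarseConvex.tendsto_powerConj hε h₁.rough).eventually_ge_atTop M,
        (CoarseConvex.tendsto_powerConj hε h₂.rough).eventually_ge_atTop M] with t h h'
      exact le_min h h'
  obtain ⟨R, hR⟩ := hB.bddAbove
  obtain ⟨N, hN⟩ := (htend.eventually_gt_atTop R).exists_forall_of_atTop
  refine (Metric.isBounded_Icc 0 N).subset fun t ht => ⟨zero_le, ?_⟩
  by_contra hlt
  exact (hN t (le_of_not_ge hlt)).not_ge (hR ht)
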